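/- Assume the continuum hypothesis. Let $X$ be a real Banach space whose density character (the least cardinality of a dense subset) is $\omega_1$, and suppose that $X$ is weakly compactly generated, i.e. contains a weakly compact subset whose linear span is dense in $X$. Then $X$ contains a relatively weakly compact overcomplete set: there is a set $S \subseteq X$ whose closure in the weak topology is weakly compact, whose cardinality equals the density character of $X$, and such that every subset $\Lambda \subseteq S$ with $|\Lambda| = |S|$ has dense linear span in $X$. -/

import Mathlib

open Cardinal

/-- The continuum hypothesis: the first uncountable cardinal is the cardinality of the continuum. -/
def ContinuumHypothesis : Prop :=
  (Cardinal.aleph 1 : Cardinal.{0}) = #ℝ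

/-- The density character of a topological space: the least cardinality of a dense subset. -/
noncomputable def densityCharacter (X : Type*) [TopologicalSpace X] : Cardinal :=
  sInf {κ : Cardinal | ∃ D : Set X, Dense D ∧ #D = κ}

section BanachSpace

variable {X : Type*} [NormedAddCommGroup X] [NormedSpace ℝ X]

/-- A set is linearly dense if its linear span is norm dense. -/
def IsLinearlyDense (S : Set X) : Prop :=
  Dense (Submodule.span ℝ S : Set X)

/-- Compactness in the weak topology of `X`. -/
def IsWeaklyCompact (K : Set X) : Prop :=
  IsCompact (toWeakSpace ℝ X '' K)

/-- Relative compactness in the weak topology: the weak closure is weakly compact. -/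
def IsRelativelyWeaklyCompact (S : Set X) : Prop :=
  IsCompact (closure (toWeakSpace ℝ X '' S))

/-- A set whose cardinality is the density character of the space, all of whose subsets of the same
cardinality are linearly dense. -/
def IsOvercomplete (S : Set X) : Prop :=
  #S = densityCharacter X ∧ ∀ Λ : Set X, Λ ⊆ S → #Λ = #S → IsLinearlyDense Λ

variable (X) in
/-- Weakly compactly generated: there is a linearly dense weakly compact subset. -/
def IsWCG : Prop :=
  ∃ K : Set X, IsWeaklyCompact K ∧ IsLinearlyDense K

end BanachSpace

/-!
A set `S` of cardinality `ℵ₁` is overcomplete as soon as every nonzero functional vanishes on only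
countably many of its points, by Hahn–Banach. If the dual `X*` has cardinality at most `ℵ₁`, its
nonzero functionals can be well-ordered with countable initial segments, and it suffices to choose,
for each functional `f`, a point `x_f` that is annihilated by no functional `g ≤ f`: a functional
`g` then vanishes on `x_f` only for `f < g`. Both halves use the weakly compact linearly dense set
`K`.

*The dual is small* (`mk_strongDual_le_continuum`). A functional is determined by its restriction to
`K`, so `X*` embeds in the space `C(K)` of weakly continuous functions on `K`. Norming functionals
of the points of a dense set of cardinality `ℵ₁` separate the points of `X`, so by Stone–Weierstrass
the algebra that they generate, which has cardinality at most the continuum, is dense in `C(K)`.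
Hence `C(K)` has at most `𝔠 ^ ℵ₀ = 𝔠` elements, and `𝔠 = ℵ₁` under the continuum hypothesis.

*The points can be chosen in one weakly compact set* (`IsWCG.exists_isWeaklyCompact_avoiding`). The
set of all series `∑ 2⁻ⁿ tₙ kₙ` with `kₙ ∈ K` and `tₙ ∈ [0, 1]` is weakly compact, being a
continuous image of a compact product; this replaces Krein's theorem on closed convex hulls. Given
countably many nonzero functionals `fₙ`, take `kₙ ∈ K` with `fₙ kₙ ≠ 0`. The parameters `t` for
which `fₙ` does not vanish on the series form a dense open subset of the cube `[0, 1]^ℕ`, because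
moving the coordinate `tₙ` changes the value of `fₙ`; by Baire some `t` works for all `n`.
-/

open Set Topology

section Functionals

variable {X : Type*} [NormedAddCommGroup X] [NormedSpace ℝ X]

/-! ### Functionals and linear density -/

theorem IsLinearlyDense.eq_zero_of_forall_apply_eq_zero {S : Set X} (hS : IsLinearlyDense S)
    {f : StrongDual ℝ X} (hf : ∀ x ∈ S, f x = 0) : f = 0 := by
  have h : (Submodule.span ℝ S : Set X) ⊆ {x | f x = 0} :=
    fun x hx ↦ (Submodule.span_le (p := f.ker)).2 (fun y hy ↦ hf y hy) hx
  have hc : IsClosed {x | f x = 0} := isClosed_eq f.continuous continuous_const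
  ext x
  exact hc.closure_subset_iff.2 h (hS x)

theorem isLinearlyDense_of_forall_eq_zero {S : Set X}
    (hS : ∀ f : StrongDual ℝ X, (∀ x ∈ S, f x = 0) → f = 0) : IsLinearlyDense S := by
  intro x
  by_contra hx
  set p := Submodule.span ℝ S
  obtain ⟨f, u, hfu, hux⟩ :=
    geometric_hahn_banach_closed_point (s := closure (p : Set X)) p.convex.closure
      isClosed_closure hx
  -- A functional bounded above on a subspace vanishes on it.
  have hf : ∀ y ∈ p, f y = 0 := by
    intro y hy
    by_contra hne
    have := hfu _ (subset_closure (p.smul_mem (u / f y) hy))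
    rw [map_smul, smul_eq_mul, div_mul_cancel₀ _ hne] at this
    exact lt_irrefl _ this
  have h0 := hS f fun y hy ↦ hf y (Submodule.subset_span hy)
  have := hfu 0 (subset_closure p.zero_mem)
  simp only [h0, zero_apply] at this hux
  exact lt_asymm this hux

/-- Norming functionals of the points of a dense set separate the points of the space. -/
theorem Dense.eq_zero_of_norming {D : Set X} (hD : Dense D) {g : D → StrongDual ℝ X}
    (hg1 : ∀ d, ‖g d‖ ≤ 1) (hg : ∀ d, g d d = ‖(d : X)‖) {x : X} (hx : ∀ d, g d x = 0) :
    x = 0 := by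
  by_contra hne
  have hpos : 0 < ‖x‖ / 2 := by positivity
  obtain ⟨d, hd, hxd⟩ := Metric.dense_iff.1 hD x _ hpos
  rw [Metric.mem_ball, dist_eq_norm] at hd
  have h1 : ‖d‖ ≤ ‖d - x‖ := by
    calc ‖d‖ = g ⟨d, hxd⟩ (d - x) := by rw [map_sub, hx, sub_zero]; exact (hg ⟨d, hxd⟩).symm
      _ ≤ ‖g ⟨d, hxd⟩ (d - x)‖ := Real.le_norm_self _
      _ ≤ 1 * ‖d - x‖ := (g ⟨d, hxd⟩).le_of_opNorm_le (hg1 _) _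
      _ = ‖d - x‖ := one_mul _
  have h2 := norm_sub_norm_le x d
  rw [norm_sub_rev] at h2
  linarith

theorem exists_dense_mk_eq_densityCharacter (Y : Type*) [TopologicalSpace Y] :
    ∃ D : Set Y, Dense D ∧ #D = densityCharacter Y :=
  csInf_mem (s := {κ : Cardinal | ∃ D : Set Y, Dense D ∧ #D = κ})
    ⟨#(univ : Set Y), univ, dense_univ, rfl⟩

theorem densityCharacter_le_aleph0 (Y : Type*) [TopologicalSpace Y]
    [TopologicalSpace.SeparableSpace Y] : densityCharacter Y ≤ ℵ₀ := by
  obtain ⟨D, hc, hD⟩ := TopologicalSpace.exists_countable_dense Y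
  have h : densityCharacter Y ≤ #D := csInf_le' ⟨D, hD, rfl⟩
  exact h.trans (Cardinal.le_aleph0_iff_set_countable.2 hc)

theorem IsLinearlyDense.not_countable {S : Set X} (hS : IsLinearlyDense S)
    (hX : ℵ₀ < densityCharacter X) : ¬ S.Countable := by
  intro hc
  have hsep : TopologicalSpace.IsSeparable (univ : Set X) := by
    rw [← hS.closure_eq]
    exact (hc.isSeparable.span (R := ℝ)).closure
  have := TopologicalSpace.isSeparable_univ_iff.1 hsep
  exact (densityCharacter_le_aleph0 X).not_gt hX

end Functionals

section Cardinality

universe u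

/-! ### The cardinality of the dual -/

theorem Dense.mk_le_continuum {Y : Type u} [TopologicalSpace Y] [T2Space Y]
    [FrechetUrysohnSpace Y] {D : Set Y} (hD : Dense D) (hc : #D ≤ 𝔠) : #Y ≤ 𝔠 := by
  have h : ∀ y : Y, ∃ s : ℕ → D, Filter.Tendsto (fun n ↦ (s n : Y)) Filter.atTop (𝓝 y) := by
    intro y
    obtain ⟨s, hs, hy⟩ := mem_closure_iff_seq_limit.1 (hD y)
    exact ⟨fun n ↦ ⟨s n, hs n⟩, hy⟩
  choose s hs using h
  have hinj : Function.Injective s := fun y z hyz ↦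
    tendsto_nhds_unique (hs y) (by rw [hyz]; exact hs z)
  calc #Y ≤ #(ℕ → D) := Cardinal.mk_le_of_injective hinj
    _ = #D ^ ℵ₀ := by simp
    _ ≤ 𝔠 ^ ℵ₀ := Cardinal.power_le_power_right hc
    _ = 𝔠 := Cardinal.continuum_power_aleph0

/-- A compact space with at most continuum many continuous functions separating its points carries
at most continuum many continuous functions, by Stone–Weierstrass. -/
theorem ContinuousMap.mk_le_continuum_of_separatesPoints {Y : Type u} [TopologicalSpace Y]
    [CompactSpace Y] {s : Set C(Y, ℝ)} (hs : #s ≤ 𝔠)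
    (hsep : ((fun f : C(Y, ℝ) ↦ (f : Y → ℝ)) '' s).SeparatesPoints) : #C(Y, ℝ) ≤ 𝔠 := by
  have htop := ContinuousMap.subalgebra_topologicalClosure_eq_top_of_separatesPoints
    (Algebra.adjoin ℝ s) fun x y hxy ↦ by
      obtain ⟨_, ⟨f, hf, rfl⟩, hne⟩ := hsep hxy
      exact ⟨_, ⟨f, Algebra.subset_adjoin hf, rfl⟩, hne⟩
  have hd : Dense (Algebra.adjoin ℝ s : Set C(Y, ℝ)) := by
    rw [dense_iff_closure_eq, ← Subalgebra.topologicalClosure_coe, htop]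
    rfl
  refine hd.mk_le_continuum ?_
  have h := Algebra.lift_cardinalMk_adjoin_le ℝ s
  rw [Cardinal.mk_real, Cardinal.lift_continuum, Cardinal.lift_uzero, Cardinal.lift_uzero] at h
  exact h.trans (sup_le (sup_le le_rfl hs) Cardinal.aleph0_le_continuum)

theorem mk_strongDual_le_continuum {X : Type u} [NormedAddCommGroup X] [NormedSpace ℝ X]
    (hX : IsWCG X) (hd : densityCharacter X ≤ 𝔠) : #(StrongDual ℝ X) ≤ 𝔠 := by
  obtain ⟨K, hK, hKd⟩ := hX
  obtain ⟨D, hD, hDc⟩ := exists_dense_mk_eq_densityCharacter X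
  choose g hg1 hg using fun d : D ↦ exists_dual_vector'' ℝ (d : X)
  have : CompactSpace (toWeakSpace ℝ X '' K) := isCompact_iff_compactSpace.1 hK
  let r : StrongDual ℝ X → C(toWeakSpace ℝ X '' K, ℝ) := fun f ↦
    ⟨fun x ↦ f ((toWeakSpace ℝ X).symm x),
      (WeakBilin.eval_continuous (topDualPairing ℝ X).flip f).comp continuous_subtype_val⟩
  have hr : Function.Injective r := by
    intro f f' hff
    rw [← sub_eq_zero]
    refine hKd.eq_zero_of_forall_apply_eq_zero fun x hx ↦ ?_
    have := DFunLike.congr_fun hff ⟨_, mem_image_of_mem _ hx⟩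
    exact sub_eq_zero.2 this
  refine (Cardinal.mk_le_of_injective hr).trans
    (ContinuousMap.mk_le_continuum_of_separatesPoints (s := range fun d ↦ r (g d)) ?_ ?_)
  · exact Cardinal.mk_range_le.trans (hDc.trans_le hd)
  · intro x y hxy
    by_contra! h
    refine hxy (Subtype.ext ((toWeakSpace ℝ X).symm.injective (sub_eq_zero.1 ?_)))
    refine hD.eq_zero_of_norming hg1 hg fun d ↦ ?_
    rw [map_sub, sub_eq_zero]
    exact h _ ⟨_, ⟨d, rfl⟩, rfl⟩

end Cardinality

section Series

variable {X : Type*} [NormedAddCommGroup X] [NormedSpace ℝ X]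

/-! ### A weakly compact set avoiding countably many hyperplanes -/

theorem IsWeaklyCompact.exists_norm_le {K : Set X} (hK : IsWeaklyCompact K) :
    ∃ M, ∀ x ∈ K, ‖x‖ ≤ M := by
  obtain ⟨M, hM⟩ := banach_steinhaus (g := fun x : K ↦ NormedSpace.inclusionInDoubleDual ℝ X x)
    fun f ↦ by
      obtain ⟨C, hC⟩ := hK.exists_bound_of_continuousOn
        (WeakBilin.eval_continuous (topDualPairing ℝ X).flip f).continuousOn
      exact ⟨C, fun x ↦ hC _ (mem_image_of_mem _ x.2)⟩
  refine ⟨M, fun x hx ↦ ?_⟩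
  rw [← (NormedSpace.inclusionInDoubleDualLi ℝ (E := X)).norm_map x]
  exact hM ⟨x, hx⟩

/-- The vector `∑ 2⁻ⁿ tₙ kₙ`. -/
noncomputable def geometricCombination (k : ℕ → X) (t : ℕ → ℝ) : X :=
  ∑' n, ((1 / 2) ^ n * t n) • k n

theorem norm_geometricCombination_term_le {k : ℕ → X} {t : ℕ → ℝ} {M : ℝ} (hk : ∀ n, ‖k n‖ ≤ M)
    (ht : ∀ n, t n ∈ Icc (0 : ℝ) 1) (n : ℕ) :
    ‖((1 / 2) ^ n * t n) • k n‖ ≤ (1 / 2) ^ n * M := by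
  rw [norm_smul, norm_mul, norm_pow, Real.norm_of_nonneg (ht n).1,
    Real.norm_of_nonneg (by norm_num : (0 : ℝ) ≤ 1 / 2)]
  refine mul_le_mul ?_ (hk n) (norm_nonneg _) (by positivity)
  exact mul_le_of_le_one_right (by positivity) (ht n).2

theorem summable_geometricCombination [CompleteSpace X] {k : ℕ → X} {t : ℕ → ℝ} {M : ℝ}
    (hk : ∀ n, ‖k n‖ ≤ M) (ht : ∀ n, t n ∈ Icc (0 : ℝ) 1) :
    Summable fun n ↦ ((1 / 2) ^ n * t n) • k n :=
  .of_norm_bounded (summable_geometric_two.mul_right M) (norm_geometricCombination_term_le hk ht)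

theorem geometricCombination_update [CompleteSpace X] {k : ℕ → X} {t : ℕ → ℝ} {M : ℝ}
    (hk : ∀ n, ‖k n‖ ≤ M) (ht : ∀ n, t n ∈ Icc (0 : ℝ) 1) (j : ℕ) (s : ℝ) :
    geometricCombination k (Function.update t j s) =
      ((1 / 2) ^ j * (s - t j)) • k j + geometricCombination k t := by
  have h := (summable_geometricCombination hk ht).hasSum.update j (((1 / 2) ^ j * s) • k j)
  rw [← sub_smul, ← mul_sub] at h
  rw [geometricCombination, geometricCombination, ← h.tsum_eq]
  refine tsum_congr fun n ↦ ?_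
  rcases eq_or_ne n j with rfl | hn
  · simp
  · simp [hn]

/-- On sequences in a bounded set, `∑ 2⁻ⁿ tₙ kₙ` depends continuously on the coefficients and, for
the weak topology, on the vectors. -/
theorem continuous_apply_geometricCombination [CompleteSpace X] {K : Set X} {M : ℝ}
    (hM : ∀ x ∈ K, ‖x‖ ≤ M) (f : StrongDual ℝ X) :
    Continuous fun z : ℕ → (toWeakSpace ℝ X '' K) × Icc (0 : ℝ) 1 ↦
      f (geometricCombination (fun n ↦ (toWeakSpace ℝ X).symm (z n).1) fun n ↦ (z n).2) := by
  have hb : ∀ y : toWeakSpace ℝ X '' K, ‖(toWeakSpace ℝ X).symm y‖ ≤ M := by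
    rintro ⟨_, x, hx, rfl⟩
    exact hM x hx
  have heq : ∀ z : ℕ → (toWeakSpace ℝ X '' K) × Icc (0 : ℝ) 1,
      f (geometricCombination (fun n ↦ (toWeakSpace ℝ X).symm (z n).1) fun n ↦ (z n).2) =
        ∑' n, f (((1 / 2) ^ n * ((z n).2 : ℝ)) • (toWeakSpace ℝ X).symm (z n).1) := fun z ↦
    f.map_tsum (summable_geometricCombination (fun n ↦ hb (z n).1) fun n ↦ (z n).2.2)
  simp only [heq]
  refine continuous_tsum (u := fun n ↦ ‖f‖ * ((1 / 2) ^ n * M)) (fun n ↦ ?_)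
    ((summable_geometric_two.mul_right M).mul_left _) fun n z ↦ ?_
  · simp only [map_smul, smul_eq_mul]
    have h0 : Continuous fun y : toWeakSpace ℝ X '' K ↦ f ((toWeakSpace ℝ X).symm y) :=
      (WeakBilin.eval_continuous (topDualPairing ℝ X).flip f).comp continuous_subtype_val
    have h1 : Continuous fun z : ℕ → (toWeakSpace ℝ X '' K) × Icc (0 : ℝ) 1 ↦
        f ((toWeakSpace ℝ X).symm (z n).1) :=
      h0.comp (continuous_fst.comp (continuous_apply n))
    refine Continuous.mul ?_ h1
    fun_prop
  · exact f.le_opNorm_of_le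
      (norm_geometricCombination_term_le (fun n ↦ hb (z n).1) (fun n ↦ (z n).2.2) n)

/-- If `f` does not vanish on `kⱼ`, then it does not vanish on `∑ 2⁻ⁿ tₙ kₙ` for generic `t`. -/
theorem dense_setOf_apply_geometricCombination_ne_zero [CompleteSpace X] {k : ℕ → X} {M : ℝ}
    (hk : ∀ n, ‖k n‖ ≤ M) {f : StrongDual ℝ X} {j : ℕ} (hf : f (k j) ≠ 0) :
    Dense {t : ℕ → Icc (0 : ℝ) 1 | f (geometricCombination k fun n ↦ t n) ≠ 0} := by
  intro t
  by_cases ht : f (geometricCombination k fun n ↦ t n) = 0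
  · have hc : Continuous fun s : Icc (0 : ℝ) 1 ↦ Function.update t j s := by fun_prop
    have := map_mem_closure hc (dense_compl_singleton (t j) (t j))
      (t := {t : ℕ → Icc (0 : ℝ) 1 | f (geometricCombination k fun n ↦ t n) ≠ 0}) fun s hs ↦ by
        have hu : (fun n ↦ (Function.update t j s n : ℝ)) =
            Function.update (fun n ↦ (t n : ℝ)) j s := by
          ext n
          rcases eq_or_ne n j with rfl | hn
          · simp
          · simp [hn]
        have hs' : (s : ℝ) - t j ≠ 0 := sub_ne_zero.2 fun h ↦ hs (Subtype.ext h)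
        rw [mem_ofPred_eq, hu, geometricCombination_update hk (fun n ↦ (t n).2), map_add, ht,
          add_zero, map_smul, smul_eq_mul]
        exact mul_ne_zero (mul_ne_zero (by positivity) hs') hf
    rwa [Function.update_eq_self] at this
  · exact subset_closure ht

theorem IsWCG.exists_isWeaklyCompact_avoiding [CompleteSpace X] (hX : IsWCG X) :
    ∃ C : Set X, IsWeaklyCompact C ∧ ∀ F : Set (StrongDual ℝ X), F.Countable → 0 ∉ F →
      F.Nonempty → ∃ x ∈ C, ∀ f ∈ F, f x ≠ 0 := by
  obtain ⟨K, hK, hKd⟩ := hX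
  obtain ⟨M, hM⟩ := hK.exists_norm_le
  have : CompactSpace (toWeakSpace ℝ X '' K) := isCompact_iff_compactSpace.1 hK
  let Φ : (ℕ → (toWeakSpace ℝ X '' K) × Icc (0 : ℝ) 1) → X := fun z ↦
    geometricCombination (fun n ↦ (toWeakSpace ℝ X).symm (z n).1) fun n ↦ (z n).2
  have hΦ : Continuous fun z ↦ toWeakSpace ℝ X (Φ z) :=
    WeakBilin.continuous_of_continuous_eval _ fun f ↦ continuous_apply_geometricCombination hM f
  refine ⟨range Φ, ?_, fun F hF h0 hne ↦ ?_⟩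
  · rw [IsWeaklyCompact, ← range_comp]
    exact isCompact_range hΦ
  obtain ⟨f, rfl⟩ := hF.exists_eq_range hne
  have hk : ∀ n, ∃ x ∈ K, f n x ≠ 0 := by
    intro n
    by_contra! h
    exact h0 ⟨n, hKd.eq_zero_of_forall_apply_eq_zero h⟩
  choose k hkK hkf using hk
  let z : (ℕ → Icc (0 : ℝ) 1) → ℕ → (toWeakSpace ℝ X '' K) × Icc (0 : ℝ) 1 :=
    fun t n ↦ (⟨_, mem_image_of_mem _ (hkK n)⟩, t n)
  have hz : Continuous z := by fun_prop
  have hopen : ∀ n, IsOpen {t : ℕ → Icc (0 : ℝ) 1 | f n (Φ (z t)) ≠ 0} := fun n ↦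
    isOpen_ne_fun ((continuous_apply_geometricCombination hM (f n)).comp hz) continuous_const
  have hdense : ∀ n, Dense {t : ℕ → Icc (0 : ℝ) 1 | f n (Φ (z t)) ≠ 0} := fun n ↦
    dense_setOf_apply_geometricCombination_ne_zero (fun n ↦ hM _ (hkK n)) (hkf n)
  obtain ⟨t, ht⟩ := (dense_iInter_of_isOpen hopen hdense).nonempty
  refine ⟨Φ (z t), mem_range_self _, ?_⟩
  rintro _ ⟨n, rfl⟩
  exact mem_iInter.1 ht n

end Series

/-! ### The overcomplete set -/

theorem ContinuumHypothesis.aleph_one_eq_continuum.{u} (h : ContinuumHypothesis) :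
    Cardinal.aleph.{u} 1 = 𝔠 := by
  have h' : Cardinal.aleph.{0} 1 = 𝔠 := h.trans Cardinal.mk_real
  simpa using congrArg Cardinal.lift.{u} h'

/-- A type of cardinality at most `ℵ₁` has a well-order with countable initial segments. -/
theorem exists_linearOrder_countable_Iic {α : Type*} (h : #α ≤ Cardinal.aleph 1) :
    ∃ _ : LinearOrder α, ∀ a : α, (Iic a).Countable := by
  obtain ⟨hl, hw, ho⟩ := Cardinal.exists_ord_eq_type_lt α
  refine ⟨hl, fun a ↦ ?_⟩
  rcases le_or_gt ℵ₀ #α with hα | hα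
  · rw [← Cardinal.le_aleph0_iff_set_countable, ← Order.lt_succ_iff, Cardinal.succ_aleph0]
    exact (Cardinal.mk_Iic_lt a ho hα).trans_le h
  · exact Cardinal.le_aleph0_iff_set_countable.1 ((Cardinal.mk_set_le _).trans hα.le)

theorem theoremB (hCH : ContinuumHypothesis) {X : Type*} [NormedAddCommGroup X] [NormedSpace ℝ X]
    [CompleteSpace X] (hWCG : IsWCG X) (hdens : densityCharacter X = Cardinal.aleph 1) :
    ∃ S : Set X, IsRelativelyWeaklyCompact S ∧ IsOvercomplete S := by
  have hdual : #{f : StrongDual ℝ X // f ≠ 0} ≤ Cardinal.aleph 1 := by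
    rw [hCH.aleph_one_eq_continuum] at hdens ⊢
    exact (Cardinal.mk_subtype_le _).trans (mk_strongDual_le_continuum hWCG hdens.le)
  obtain ⟨_, hord⟩ := exists_linearOrder_countable_Iic hdual
  obtain ⟨C, hC, havoid⟩ := hWCG.exists_isWeaklyCompact_avoiding
  have hx : ∀ f : {f : StrongDual ℝ X // f ≠ 0}, ∃ x ∈ C, ∀ g ≤ f, g.1 x ≠ 0 := by
    intro f
    obtain ⟨x, hxC, hx⟩ := havoid (Subtype.val '' Iic f) ((hord f).image _)
      (fun ⟨g, _, hg⟩ ↦ g.2 hg) (nonempty_Iic.image _)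
    exact ⟨x, hxC, fun g hg ↦ hx _ (mem_image_of_mem _ hg)⟩
  choose x hxC hx using hx
  have hdense : ∀ Λ ⊆ range x, ¬ Λ.Countable → IsLinearlyDense Λ := by
    intro Λ hΛ hunc
    refine isLinearlyDense_of_forall_eq_zero fun f hf ↦ ?_
    by_contra hne
    refine hunc (((hord ⟨f, hne⟩).image x).mono fun y hy ↦ ?_)
    obtain ⟨g, rfl⟩ := hΛ hy
    refine mem_image_of_mem _ (not_lt.1 fun hlt ↦ hx g ⟨f, hne⟩ hlt.le (hf _ hy))
  have hrange : IsLinearlyDense (range x) := by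
    refine isLinearlyDense_of_forall_eq_zero fun f hf ↦ ?_
    by_contra hne
    exact hx ⟨f, hne⟩ ⟨f, hne⟩ le_rfl (hf _ (mem_range_self _))
  have hunc : ¬ (range x).Countable :=
    hrange.not_countable (by rw [hdens]; exact Cardinal.aleph0_lt_aleph_one)
  have hcard : #(range x) = Cardinal.aleph 1 := by
    refine le_antisymm (Cardinal.mk_range_le.trans hdual) ?_
    rw [← Cardinal.succ_aleph0, Order.succ_le_iff, ← not_le]
    rwa [Cardinal.le_aleph0_iff_set_countable]
  refine ⟨range x, ?_, hcard.trans hdens.symm, fun Λ hΛ hΛc ↦ hdense Λ hΛ fun hc ↦ ?_⟩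
  · exact IsCompact.closure_of_subset hC (image_mono (range_subset_iff.2 hxC))
  · rw [← Cardinal.le_aleph0_iff_set_countable, hΛc, hcard] at hc
    exact hc.not_gt Cardinal.aleph0_lt_aleph_one
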